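/- Let $n\ge 0$ and let $S_n$ be the symmetric group with simple reflections $S=\{s_i=(i\ \,i{+}1) : 1\le i\le n-1\}$ and Coxeter length $\ell$ (the least number of factors in an expression as a product of elements of $S$). The reflections are the conjugates of the elements of $S$. The Bruhat graph $\Gamma$ has vertex set $S_n$ and an edge $x\to y$ whenever $yx^{-1}$ is a reflection and $\ell(x)<\ell(y)$. Bruhat order is defined by $x\le y$ if and only if there is a directed path from $x$ to $y$ in $\Gamma$. For $u\le v$ let $\Gamma(u,v)$ be the induced subgraph of $\Gamma$ on the interval $[u,v]$. A $k$-hypercube in $\Gamma(u,v)$ is a subgraph isomorphic to the Hasse diagram (directed upwards) of the Boolean lattice of subsets of a $k$-element set; it is spanned by the set of endpoints of the edges leaving its bottom vertex. A $2$-hypercube is called a diamond. A subset $I\subseteq[u,v]$ is diamond-closed if, whenever $I$ contains three vertices of a diamond in $\Gamma(u,v)$, it contains the fourth. A hypercube decomposition of $[u,v]$ is a subset $I\subseteq [u,v]$ such that $I=[u,z]$ for some $z\in[u,v]$, $I$ is diamond-closed, and for every $x\in I$ and every antichain $Y$ (in Bruhat order) contained in $\{y\in[u,v]\setminus I : x\to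 y\}$ there is a unique hypercube in $\Gamma(u,v)$ with bottom vertex $x$ spanned by $Y$. For $J\subseteq S$, let $W_J$ be the standard parabolic subgroup of $S_n$ generated by $J$. **Proposition.** Let $v\in S_n$ and let $e$ be the identity. 1. Let $I$ be a nonempty diamond-closed order ideal of $[e,v]$. Then $I=[e,v]\cap W_J$ for some $J\subseteq S$. Moreover, $I$ is a principal order ideal of $[e,v]$, i.e. $I=[e,z]$ for some $z\in[e,v]$. 2. Let $I$ be a hypercube decomposition of $[e,v]$, and let $J$ be the set of atoms of $I$ (the minimal elements of $I\setminus\{e\}$ in Bruhat order). Then $J\subseteq S$ and $I=[e,v]\cap W_J$. -/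

import Mathlib

namespace BruhatSn

/-- The simple reflections `s_i = (i i+1)` of the symmetric group `S_n = Equiv.Perm (Fin n)`. -/
def simpleReflections (n : ℕ) : Set (Equiv.Perm (Fin n)) :=
  {s | ∃ i j : Fin n, (i : ℕ) + 1 = (j : ℕ) ∧ s = Equiv.swap i j}

/-- Every permutation is a product of simple reflections, so that the set of lengths of words
for `w` in the definition of `length` below is never empty. -/
theorem exists_word {n : ℕ} (w : Equiv.Perm (Fin n)) :
    ∃ L : List (Equiv.Perm (Fin n)), (∀ s ∈ L, s ∈ simpleReflections n) ∧ L.prod = w := by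
  cases n with
  | zero => exact ⟨[], by simp, Subsingleton.elim _ _⟩
  | succ m =>
    have h : w ∈ Submonoid.closure (Set.range fun i : Fin m ↦ Equiv.swap i.castSucc i.succ) := by
      rw [Equiv.Perm.mclosure_swap_castSucc_succ]
      trivial
    obtain ⟨L, hL, hw⟩ := Submonoid.exists_list_of_mem_closure h
    refine ⟨L, fun s hs ↦ ?_, hw⟩
    obtain ⟨i, rfl⟩ := hL s hs
    exact ⟨i.castSucc, i.succ, by simp, rfl⟩

/-- The Coxeter length: the least length of a word in the simple reflections with product `w`. -/
noncomputable def length {n : ℕ} (w : Equiv.Perm (Fin n)) : ℕ :=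
  sInf {k | ∃ L : List (Equiv.Perm (Fin n)),
    (∀ s ∈ L, s ∈ simpleReflections n) ∧ L.prod = w ∧ L.length = k}

/-- The reflections: conjugates of simple reflections. -/
def IsReflection {n : ℕ} (t : Equiv.Perm (Fin n)) : Prop :=
  ∃ s ∈ simpleReflections n, ∃ w : Equiv.Perm (Fin n), t = w * s * w⁻¹

/-- The edges `x → y` of the Bruhat graph. -/
def Edge {n : ℕ} (x y : Equiv.Perm (Fin n)) : Prop :=
  IsReflection (y * x⁻¹) ∧ length x < length y

/-- Bruhat order: there is a (possibly trivial) path from `x` to `y` in the Bruhat graph. -/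
def Le {n : ℕ} (x y : Equiv.Perm (Fin n)) : Prop :=
  Relation.ReflTransGen Edge x y

/-- The Bruhat interval `[u, v]`. -/
def interval {n : ℕ} (u v : Equiv.Perm (Fin n)) : Set (Equiv.Perm (Fin n)) :=
  {x | Le u x ∧ Le x v}

/-- `I` is an order ideal of the poset `[u, v]`. -/
def IsOrderIdeal {n : ℕ} (u v : Equiv.Perm (Fin n)) (I : Set (Equiv.Perm (Fin n))) : Prop :=
  I ⊆ interval u v ∧ ∀ x ∈ I, ∀ y ∈ interval u v, Le y x → y ∈ I

/-- `I` is a principal order ideal of `[u, v]`: all elements weakly below some `z ∈ [u, v]`. -/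
def IsPrincipalOrderIdeal {n : ℕ} (u v : Equiv.Perm (Fin n)) (I : Set (Equiv.Perm (Fin n))) :
    Prop :=
  ∃ z ∈ interval u v, I = {x | x ∈ interval u v ∧ Le x z}

/-- The atoms of a subset `I` that has least element `u`: the minimal elements of `I \ {u}`. -/
def atoms {n : ℕ} (u : Equiv.Perm (Fin n)) (I : Set (Equiv.Perm (Fin n))) :
    Set (Equiv.Perm (Fin n)) :=
  {x | x ∈ I ∧ x ≠ u ∧ ∀ y ∈ I, Le y x → y = u ∨ y = x}

/-- `f` embeds the hypercube graph (the Hasse diagram of the Boolean lattice of subsets of a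
`k`-element set, directed upwards) as a subgraph of `Γ(u, v)`, the induced subgraph of the Bruhat
graph on `[u, v]`. A `k`-hypercube of `Γ(u, v)` is the image of such an `f`. -/
def IsHypercubeMap {n : ℕ} (u v : Equiv.Perm (Fin n)) {k : ℕ}
    (f : Finset (Fin k) → Equiv.Perm (Fin n)) : Prop :=
  Function.Injective f ∧ (∀ S, f S ∈ interval u v) ∧ ∀ S T, S ⋖ T → Edge (f S) (f T)

/-- `I` is diamond-closed in `[u, v]`: whenever three vertices of a diamond (a 2-hypercube) of
`Γ(u, v)` lie in `I`, so does the fourth vertex. -/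
def IsDiamondClosed {n : ℕ} (u v : Equiv.Perm (Fin n)) (I : Set (Equiv.Perm (Fin n))) : Prop :=
  ∀ f : Finset (Fin 2) → Equiv.Perm (Fin n), IsHypercubeMap u v f →
    ∀ S, (∀ T, T ≠ S → f T ∈ I) → f S ∈ I

/-- The pair of a vertex set and an edge set `(V, E)` is a hypercube of `Γ(u, v)` with bottom
vertex `x`, spanned by `Y`: the edges going up from `x` in it end exactly at the elements of
`Y`. -/
def IsSpannedHypercube {n : ℕ} (u v x : Equiv.Perm (Fin n)) (Y : Set (Equiv.Perm (Fin n)))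
    (H : Set (Equiv.Perm (Fin n)) × Set (Equiv.Perm (Fin n) × Equiv.Perm (Fin n))) : Prop :=
  ∃ (k : ℕ) (f : Finset (Fin k) → Equiv.Perm (Fin n)), IsHypercubeMap u v f ∧
    H.1 = Set.range f ∧ H.2 = {e | ∃ S T, S ⋖ T ∧ e = (f S, f T)} ∧
    f ∅ = x ∧ Set.range (fun i : Fin k ↦ f {i}) = Y

/-- The elements of `[u, v] \ I` that are reached from `x` by an edge of the Bruhat graph. -/
def outNeighbors {n : ℕ} (u v : Equiv.Perm (Fin n)) (I : Set (Equiv.Perm (Fin n)))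
    (x : Equiv.Perm (Fin n)) : Set (Equiv.Perm (Fin n)) :=
  {y | y ∈ interval u v ∧ y ∉ I ∧ Edge x y}

/-- There is a hypercube cluster at `x` relative to `I`: every antichain of out-neighbours of `x`
outside `I` spans a unique hypercube of `Γ(u, v)` with bottom vertex `x`. -/
def HasHypercubeCluster {n : ℕ} (u v : Equiv.Perm (Fin n)) (I : Set (Equiv.Perm (Fin n)))
    (x : Equiv.Perm (Fin n)) : Prop :=
  ∀ Y : Set (Equiv.Perm (Fin n)), Y ⊆ outNeighbors u v I x → IsAntichain Le Y →
    ∃! H, IsSpannedHypercube u v x Y H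

/-- `I` is a hypercube decomposition of `[u, v]`. -/
def IsHypercubeDecomposition {n : ℕ} (u v : Equiv.Perm (Fin n))
    (I : Set (Equiv.Perm (Fin n))) : Prop :=
  (∃ z ∈ interval u v, I = interval u z) ∧ IsDiamondClosed u v I ∧
    ∀ x ∈ I, HasHypercubeCluster u v I x

end BruhatSn

namespace BruhatSn

/-! Put J = I ∩ S. Letters of a reduced word of x lie below x, so an order ideal I lies in W_J.
Conversely, let x ∈ [e,v] ∩ W_J and induct on length. If x = stw is reduced with s ≠ t, then s and t
are in J and w → tw → x. A second path from w to x runs through sw if sw is longer than w, and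
through stsw otherwise. This is a diamond in W_J whose three lower vertices are in I by induction,
so its top x is in I.

For principality, delete from a reduced word of v the letters outside J; the Demazure product of the
remaining word is the maximum of [e,v] ∩ W_J. For a hypercube decomposition, [e,z] is an order ideal
whose atoms are exactly I ∩ S.

All this rests on strong exchange, proved by tracking one inverted pair through a word, and on the
subword property deduced from it. -/

variable {n : ℕ}

/-! ### Words, length and reflections -/

/-- A word in the simple reflections. -/
def IsWord (L : List (Equiv.Perm (Fin n))) : Prop := ∀ s ∈ L, s ∈ simpleReflections n

theorem IsWord.sublist {L M : List (Equiv.Perm (Fin n))} (hL : IsWord L) (h : M.Sublist L) :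
    IsWord M := fun s hs ↦ hL s (h.subset hs)

theorem length_prod_le {L : List (Equiv.Perm (Fin n))} (hL : IsWord L) :
    length L.prod ≤ L.length :=
  Nat.sInf_le ⟨L, hL, rfl, rfl⟩

theorem exists_reduced_word (w : Equiv.Perm (Fin n)) :
    ∃ L, IsWord L ∧ L.prod = w ∧ L.length = length w := by
  obtain ⟨L, hL, hw⟩ := exists_word w
  exact Nat.sInf_mem (s := {k | ∃ L : List (Equiv.Perm (Fin n)),
    (∀ s ∈ L, s ∈ simpleReflections n) ∧ L.prod = w ∧ L.length = k}) ⟨_, L, hL, hw, rfl⟩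

theorem simple_mul_self {s : Equiv.Perm (Fin n)} (hs : s ∈ simpleReflections n) : s * s = 1 := by
  obtain ⟨i, j, -, rfl⟩ := hs
  exact Equiv.swap_mul_self i j

theorem simple_mul_cancel {s : Equiv.Perm (Fin n)} (hs : s ∈ simpleReflections n)
    (x : Equiv.Perm (Fin n)) : s * (s * x) = x := by
  rw [← mul_assoc, simple_mul_self hs, one_mul]

theorem simple_inv {s : Equiv.Perm (Fin n)} (hs : s ∈ simpleReflections n) : s⁻¹ = s :=
  inv_eq_of_mul_eq_one_left (simple_mul_self hs)

theorem simple_ne_one {s : Equiv.Perm (Fin n)} (hs : s ∈ simpleReflections n) : s ≠ 1 := by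
  obtain ⟨i, j, hij, rfl⟩ := hs
  intro h
  have := Equiv.swap_eq_one_iff.1 h
  omega

theorem length_simple_mul_le {s : Equiv.Perm (Fin n)} (hs : s ∈ simpleReflections n)
    (x : Equiv.Perm (Fin n)) : length (s * x) ≤ length x + 1 := by
  obtain ⟨L, hL, rfl, hlen⟩ := exists_reduced_word x
  rw [← hlen, ← List.prod_cons]
  exact length_prod_le (L := s :: L) (by simpa [IsWord] using ⟨hs, hL⟩)

theorem IsReflection.of_simple {s : Equiv.Perm (Fin n)} (hs : s ∈ simpleReflections n) :
    IsReflection s := ⟨s, hs, 1, by simp⟩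

theorem IsReflection.conj {t : Equiv.Perm (Fin n)} (ht : IsReflection t)
    (w : Equiv.Perm (Fin n)) : IsReflection (w * t * w⁻¹) := by
  obtain ⟨s, hs, u, rfl⟩ := ht
  exact ⟨s, hs, w * u, by group⟩

theorem IsReflection.exists_swap {t : Equiv.Perm (Fin n)} (ht : IsReflection t) :
    ∃ a b, a < b ∧ t = Equiv.swap a b := by
  obtain ⟨_, ⟨i, j, hij, rfl⟩, w, rfl⟩ := ht
  have hne : w i ≠ w j := fun h ↦ by
    have := w.injective h
    omega
  have h : w * Equiv.swap i j * w⁻¹ = Equiv.swap (w i) (w j) := by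
    rw [Equiv.mul_swap_eq_swap_mul, mul_inv_cancel_right]
  rcases lt_or_gt_of_ne hne with hlt | hlt
  · exact ⟨_, _, hlt, h⟩
  · exact ⟨_, _, hlt, by rw [h, Equiv.swap_comm]⟩

/-- A simple reflection preserves the order of every pair other than its own. -/
theorem simple_lt_or_eq {s : Equiv.Perm (Fin n)} (hs : s ∈ simpleReflections n) {a b : Fin n}
    (hab : a < b) : s a < s b ∨ s = Equiv.swap a b := by
  obtain ⟨i, j, hij, rfl⟩ := hs
  by_cases h : a = i ∧ b = j
  · right
    rw [h.1, h.2]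
  · left
    simp only [Equiv.swap_apply_def]
    split_ifs <;> grind

/-! ### Strong exchange and edges of the Bruhat graph -/

/-- The strong exchange property. -/
theorem exists_sublist_of_inverted (L : List (Equiv.Perm (Fin n))) (hL : IsWord L) {a b : Fin n}
    (hab : a < b) (h : L.prod⁻¹ b < L.prod⁻¹ a) :
    ∃ M : List (Equiv.Perm (Fin n)), M.Sublist L ∧ M.length < L.length ∧
      M.prod = Equiv.swap a b * L.prod := by
  induction L generalizing a b with
  | nil => simp at h; omega
  | cons s L ih =>
    have hs : s ∈ simpleReflections n := hL s (by simp)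
    -- Either conjugation by `s` gives `swap (s a) (s b)`, whose pair is inverted by the tail, or
    -- `s` is `swap a b` and is the letter to delete.
    rcases simple_lt_or_eq hs hab with hlt | rfl
    · rw [List.prod_cons, mul_inv_rev, simple_inv hs] at h
      obtain ⟨M, hML, hlen, hM⟩ := ih (hL.sublist (List.sublist_cons_self s L)) hlt h
      refine ⟨s :: M, hML.cons_cons s, by simpa using hlen, ?_⟩
      rw [List.prod_cons, List.prod_cons, hM, ← mul_assoc, ← mul_assoc,
        Equiv.mul_swap_eq_swap_mul, ← Equiv.Perm.mul_apply, ← Equiv.Perm.mul_apply,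
        simple_mul_self hs]
      rfl
    · exact ⟨L, List.sublist_cons_self _ L, by simp, by
        rw [List.prod_cons, Equiv.swap_mul_self_mul]⟩

theorem length_swap_mul_lt {x : Equiv.Perm (Fin n)} {a b : Fin n} (hab : a < b)
    (h : x⁻¹ b < x⁻¹ a) : length (Equiv.swap a b * x) < length x := by
  obtain ⟨L, hL, rfl, hlen⟩ := exists_reduced_word x
  obtain ⟨M, hML, hlt, hM⟩ := exists_sublist_of_inverted L hL hab h
  rw [← hM]
  exact (length_prod_le (hL.sublist hML)).trans_lt (hlt.trans_eq hlen)

theorem length_lt_length_swap_mul_iff {x : Equiv.Perm (Fin n)} {a b : Fin n} (hab : a < b) :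
    length x < length (Equiv.swap a b * x) ↔ x⁻¹ a < x⁻¹ b := by
  constructor
  · intro h
    by_contra hn
    have hne : x⁻¹ a ≠ x⁻¹ b := fun h ↦ hab.ne (x⁻¹.injective h)
    exact absurd (length_swap_mul_lt hab (lt_of_le_of_ne (not_lt.1 hn) hne.symm)) h.not_gt
  · intro h
    have := length_swap_mul_lt (x := Equiv.swap a b * x) hab (by simpa using h)
    rwa [Equiv.swap_mul_self_mul] at this

/-- Left multiplication by a reflection changes the length. -/
theorem length_mul_lt_or_gt {t : Equiv.Perm (Fin n)} (ht : IsReflection t)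
    (x : Equiv.Perm (Fin n)) : length (t * x) < length x ∨ length x < length (t * x) := by
  obtain ⟨a, b, hab, rfl⟩ := ht.exists_swap
  rw [length_lt_length_swap_mul_iff hab]
  have hne : x⁻¹ a ≠ x⁻¹ b := fun h ↦ hab.ne (x⁻¹.injective h)
  exact (lt_or_gt_of_ne hne).symm.imp_left (length_swap_mul_lt hab)

/-- The strong exchange property, in terms of lengths. -/
theorem exists_sublist_of_length_lt {L : List (Equiv.Perm (Fin n))} (hL : IsWord L)
    {t : Equiv.Perm (Fin n)} (ht : IsReflection t) (h : length (t * L.prod) < length L.prod) :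
    ∃ M : List (Equiv.Perm (Fin n)), M.Sublist L ∧ M.length < L.length ∧ M.prod = t * L.prod := by
  obtain ⟨a, b, hab, rfl⟩ := ht.exists_swap
  refine exists_sublist_of_inverted L hL hab (lt_of_le_of_ne (not_lt.1 fun hlt ↦ ?_)
    fun he ↦ hab.ne' (L.prod⁻¹.injective he))
  exact h.not_gt ((length_lt_length_swap_mul_iff hab).2 hlt)

theorem edge_mul {t x : Equiv.Perm (Fin n)} (ht : IsReflection t)
    (h : length x < length (t * x)) : Edge x (t * x) :=
  ⟨by rwa [mul_inv_cancel_right], h⟩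

/-- If `x → y` is an edge then so is `sx → sy`, unless `sx = y`. -/
theorem Edge.simple_mul {s x y : Equiv.Perm (Fin n)} (hs : s ∈ simpleReflections n)
    (h : Edge x y) : s * x = y ∨ Edge (s * x) (s * y) := by
  have ht := h.1
  obtain ⟨a, b, hab, hswap⟩ := h.1.exists_swap
  obtain rfl : y = Equiv.swap a b * x := by rw [← hswap, inv_mul_cancel_right]
  rcases simple_lt_or_eq hs hab with hlt | rfl
  · right
    have hinv := (length_lt_length_swap_mul_iff hab).1 h.2
    have heq : s * (Equiv.swap a b * x) = Equiv.swap (s a) (s b) * (s * x) := by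
      rw [← mul_assoc, Equiv.mul_swap_eq_swap_mul, mul_assoc]
    refine ⟨?_, ?_⟩
    · have := (hswap ▸ ht).conj s
      convert this using 1
      group
    · rw [heq, length_lt_length_swap_mul_iff hlt]
      simpa using hinv
  · exact Or.inl rfl

/-! ### Subword property via Demazure products -/

/-- Each edge, followed downwards, is one strong exchange, so `L` need not be reduced. -/
theorem Le.exists_sublist {x y : Equiv.Perm (Fin n)} (h : Le x y)
    {L : List (Equiv.Perm (Fin n))} (hL : IsWord L) (hy : L.prod = y) :
    ∃ M : List (Equiv.Perm (Fin n)), M.Sublist L ∧ M.prod = x := by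
  induction h using Relation.ReflTransGen.head_induction_on with
  | refl => exact ⟨L, List.Sublist.refl L, hy⟩
  | @head x z hxz _ ih =>
    obtain ⟨M, hML, rfl⟩ := ih
    have ht : IsReflection (x * M.prod⁻¹) := by
      obtain ⟨s, hs, w, hw⟩ := hxz.1
      refine ⟨s, hs, w, ?_⟩
      rw [← inv_inj, mul_inv_rev, inv_inv, hw]
      simp [mul_assoc, simple_inv hs]
    obtain ⟨N, hNM, -, hN⟩ := exists_sublist_of_length_lt (hL.sublist hML) ht
      (by rw [inv_mul_cancel_right]; exact hxz.2)
    exact ⟨N, hNM.trans hML, by rw [hN, inv_mul_cancel_right]⟩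

/-- The Demazure product of a word. -/
noncomputable def demazure : List (Equiv.Perm (Fin n)) → Equiv.Perm (Fin n)
  | [] => 1
  | s :: L => if length (demazure L) < length (s * demazure L) then s * demazure L else demazure L

theorem exists_sublist_prod_eq_demazure (L : List (Equiv.Perm (Fin n))) :
    ∃ M : List (Equiv.Perm (Fin n)), M.Sublist L ∧ M.prod = demazure L := by
  induction L with
  | nil => exact ⟨[], List.Sublist.refl _, rfl⟩
  | cons s L ih =>
    obtain ⟨M, hM, hp⟩ := ih
    rw [demazure]
    split_ifs
    · exact ⟨s :: M, hM.cons_cons s, by rw [List.prod_cons, hp]⟩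
    · exact ⟨M, hM.cons s, hp⟩

theorem demazure_le_demazure_cons {s : Equiv.Perm (Fin n)} (hs : s ∈ simpleReflections n)
    (L : List (Equiv.Perm (Fin n))) : Le (demazure L) (demazure (s :: L)) := by
  rw [demazure]
  split_ifs with h
  · exact .single (edge_mul (.of_simple hs) h)
  · exact .refl

/-- Multiplying a path up to `demazure L` by `s` keeps its edges, until an edge that is itself
multiplication by `s`; there `s * x` is the next vertex, already below `demazure L`. -/
theorem Le.simple_mul_demazure {s x : Equiv.Perm (Fin n)} (hs : s ∈ simpleReflections n)
    {L : List (Equiv.Perm (Fin n))} (h : Le x (demazure L)) :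
    Le (s * x) (demazure (s :: L)) := by
  induction h using Relation.ReflTransGen.head_induction_on with
  | refl =>
    rw [demazure]
    split_ifs with h
    · exact .refl
    · have h' := (length_mul_lt_or_gt (.of_simple hs) (demazure L)).resolve_right h
      have he := edge_mul (x := s * demazure L) (.of_simple hs)
        (by rwa [simple_mul_cancel hs])
      rw [simple_mul_cancel hs] at he
      exact .single he
  | head hxz hzy ih =>
    rcases hxz.simple_mul hs with rfl | he
    · exact Relation.ReflTransGen.trans hzy (demazure_le_demazure_cons hs L)
    · exact .head he ih

theorem prod_le_demazure_of_sublist {L M : List (Equiv.Perm (Fin n))} (hL : IsWord L)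
    (h : M.Sublist L) : Le M.prod (demazure L) := by
  induction h with
  | slnil => exact .refl
  | cons s h ih =>
    exact Relation.ReflTransGen.trans (ih (hL.sublist (List.sublist_cons_self _ _)))
      (demazure_le_demazure_cons (hL s (by simp)) _)
  | cons_cons s h ih =>
    rw [List.prod_cons]
    exact Le.simple_mul_demazure (hL s (by simp)) (ih (hL.sublist (List.sublist_cons_self _ _)))

theorem demazure_eq_prod {L : List (Equiv.Perm (Fin n))} (hL : IsWord L)
    (hred : L.length = length L.prod) : demazure L = L.prod := by
  induction L with
  | nil => rfl
  | cons s L ih =>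
    have hs : s ∈ simpleReflections n := hL s (by simp)
    have hL' := hL.sublist (List.sublist_cons_self s L)
    have h1 := length_prod_le hL'
    have h2 := length_simple_mul_le hs L.prod
    rw [List.length_cons, List.prod_cons] at hred
    rw [demazure, ih hL' (by omega), if_pos (by omega), List.prod_cons]

/-- The subword property. -/
theorem prod_le_prod_of_sublist {L M : List (Equiv.Perm (Fin n))} (hL : IsWord L)
    (hred : L.length = length L.prod) (h : M.Sublist L) : Le M.prod L.prod :=
  demazure_eq_prod hL hred ▸ prod_le_demazure_of_sublist hL h

theorem one_le (x : Equiv.Perm (Fin n)) : Le 1 x := by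
  obtain ⟨L, hL, rfl, hlen⟩ := exists_reduced_word x
  exact prod_le_prod_of_sublist hL hlen (List.nil_sublist L)

/-! ### Standard parabolic subgroups -/

section Parabolic

variable {J : Set (Equiv.Perm (Fin n))}

theorem exists_word_of_mem_closure (hJ : J ⊆ simpleReflections n) {x : Equiv.Perm (Fin n)}
    (hx : x ∈ Subgroup.closure J) : ∃ L : List (Equiv.Perm (Fin n)), (∀ s ∈ L, s ∈ J) ∧
      L.prod = x := by
  induction hx using Subgroup.closure_induction with
  | mem s hs => exact ⟨[s], by simpa using hs, by simp⟩
  | one => exact ⟨[], by simp, rfl⟩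
  | mul x y _ _ hx hy =>
    obtain ⟨L, hL, rfl⟩ := hx
    obtain ⟨M, hM, rfl⟩ := hy
    exact ⟨L ++ M, fun s hs ↦ (List.mem_append.1 hs).elim (hL s) (hM s), List.prod_append⟩
  | inv x _ hx =>
    obtain ⟨L, hL, rfl⟩ := hx
    refine ⟨L.reverse, fun s hs ↦ hL s (List.mem_reverse.1 hs), ?_⟩
    rw [List.prod_inv_reverse, List.map_congr_left (fun s hs ↦ simple_inv (hJ (hL s hs))),
      List.map_id']

theorem prod_mem_closure {L : List (Equiv.Perm (Fin n))} (hL : ∀ s ∈ L, s ∈ J) :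
    L.prod ∈ Subgroup.closure J :=
  list_prod_mem fun s hs ↦ Subgroup.subset_closure (hL s hs)

theorem Le.mem_closure (hJ : J ⊆ simpleReflections n) {x y : Equiv.Perm (Fin n)} (h : Le x y)
    (hy : y ∈ Subgroup.closure J) : x ∈ Subgroup.closure J := by
  obtain ⟨L, hL, hLy⟩ := exists_word_of_mem_closure hJ hy
  obtain ⟨M, hM, rfl⟩ := h.exists_sublist (fun s hs ↦ hJ (hL s hs)) hLy
  exact prod_mem_closure fun s hs ↦ hL s (hM.subset hs)

/-- If (i i+1) is not in `J`, every generator, hence all of W_J, preserves {k ≤ i}, which (i i+1)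
does not. -/
theorem simple_mem_of_mem_closure (hJ : J ⊆ simpleReflections n) {s : Equiv.Perm (Fin n)}
    (hs : s ∈ simpleReflections n) (h : s ∈ Subgroup.closure J) : s ∈ J := by
  by_contra hsJ
  obtain ⟨i, j, hij, rfl⟩ := hs
  have key : ∀ w ∈ Subgroup.closure J, ∀ k : Fin n, w k ≤ i ↔ k ≤ i := by
    intro w hw
    induction hw using Subgroup.closure_induction with
    | mem w hw =>
      obtain ⟨i', j', hij', rfl⟩ := hJ hw
      have hne : i' ≠ i := by
        rintro rfl
        obtain rfl : j = j' := Fin.ext (by omega)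
        exact hsJ hw
      intro k
      simp only [Equiv.swap_apply_def]
      split_ifs <;> grind
    | one => simp
    | mul x y _ _ hx hy => exact fun k ↦ by rw [Equiv.Perm.mul_apply, hx, hy]
    | inv x _ hx =>
      intro k
      rw [← hx, ← Equiv.Perm.mul_apply, mul_inv_cancel, Equiv.Perm.one_apply]
  have := (key _ h i).2 le_rfl
  rw [Equiv.swap_apply_left] at this
  omega

/-- Exchange in a `J`-word of `x` shows that `s * x`, hence `s`, is in W_J. -/
theorem descent_mem (hJ : J ⊆ simpleReflections n) {s x : Equiv.Perm (Fin n)}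
    (hs : s ∈ simpleReflections n) (hx : x ∈ Subgroup.closure J)
    (h : length (s * x) < length x) : s ∈ J := by
  obtain ⟨L, hL, rfl⟩ := exists_word_of_mem_closure hJ hx
  obtain ⟨M, hM, -, hp⟩ :=
    exists_sublist_of_length_lt (fun s hs ↦ hJ (hL s hs)) (.of_simple hs) h
  have hMJ : M.prod ∈ Subgroup.closure J := prod_mem_closure fun s hs ↦ hL s (hM.subset hs)
  rw [hp] at hMJ
  exact simple_mem_of_mem_closure hJ hs ((Subgroup.mul_mem_cancel_right _ hx).1 hMJ)

/-- A first letter outside `J` is not a left descent of the product, so exchange absorbs it by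
deleting letters from the tail. -/
theorem exists_sublist_of_prod_mem_closure (hJ : J ⊆ simpleReflections n)
    (L : List (Equiv.Perm (Fin n))) (hL : IsWord L) (hx : L.prod ∈ Subgroup.closure J) :
    ∃ M : List (Equiv.Perm (Fin n)), M.Sublist L ∧ (∀ s ∈ M, s ∈ J) ∧ M.prod = L.prod := by
  induction hk : L.length using Nat.strong_induction_on generalizing L with
  | _ k ih =>
    subst hk
    cases L with
    | nil => exact ⟨[], List.Sublist.refl _, by simp, rfl⟩
    | cons s L =>
      have hs : s ∈ simpleReflections n := hL s (by simp)
      have hL' := hL.sublist (List.sublist_cons_self s L)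
      rw [List.prod_cons] at hx
      by_cases hsJ : s ∈ J
      · obtain ⟨M, hM, hMJ, hp⟩ := ih _ (by simp) L hL'
          ((Subgroup.mul_mem_cancel_left _ (Subgroup.subset_closure hsJ)).1 hx) rfl
        exact ⟨s :: M, hM.cons_cons s, by simpa using ⟨hsJ, hMJ⟩, by simp [hp]⟩
      · have hlt : length (s * L.prod) < length L.prod := by
          refine (length_mul_lt_or_gt (.of_simple hs) _).resolve_right fun hlt ↦ hsJ ?_
          exact descent_mem hJ hs hx (by rwa [simple_mul_cancel hs])
        obtain ⟨M, hM, hlen, hp⟩ := exists_sublist_of_length_lt hL' (.of_simple hs) hlt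
        obtain ⟨N, hN, hNJ, hNp⟩ := ih M.length (by simp; omega) M (hL'.sublist hM)
          (by rwa [hp]) rfl
        exact ⟨N, (hN.trans hM).cons s, hNJ, by rw [hNp, hp, List.prod_cons]⟩

/-- The intersection of `[e, v]` with a standard parabolic subgroup has a greatest element. -/
theorem isPrincipalOrderIdeal_inter_closure (hJ : J ⊆ simpleReflections n)
    (v : Equiv.Perm (Fin n)) :
    IsPrincipalOrderIdeal 1 v (interval 1 v ∩ (Subgroup.closure J : Set (Equiv.Perm (Fin n)))) := by
  classical
  obtain ⟨L, hL, rfl, hlen⟩ := exists_reduced_word v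
  -- `K` need not be reduced, hence the Demazure product. It is also the product of a subword of
  -- `K`, which puts it in W_J and below `v`.
  set K := L.filter (· ∈ J) with hK
  have hKL : K.Sublist L := List.filter_sublist
  have hKJ : ∀ s ∈ K, s ∈ J := fun s hs ↦ by simpa using (List.mem_filter.1 hs).2
  obtain ⟨M, hM, hMd⟩ := exists_sublist_prod_eq_demazure K
  have hzJ : demazure K ∈ Subgroup.closure J :=
    hMd ▸ prod_mem_closure fun s hs ↦ hKJ s (hM.subset hs)
  refine ⟨demazure K, ⟨one_le _, hMd ▸ prod_le_prod_of_sublist hL hlen (hM.trans hKL)⟩, ?_⟩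
  ext x
  refine ⟨fun ⟨hx, hxJ⟩ ↦ ⟨hx, ?_⟩, fun ⟨hx, hxz⟩ ↦ ⟨hx, Le.mem_closure hJ hxz hzJ⟩⟩
  obtain ⟨A, hA, rfl⟩ := hx.2.exists_sublist hL rfl
  obtain ⟨B, hB, hBJ, hp⟩ := exists_sublist_of_prod_mem_closure hJ A (hL.sublist hA) hxJ
  rw [← hp]
  refine prod_le_demazure_of_sublist (hL.sublist hKL) ?_
  have := (hB.trans hA).filter (· ∈ J)
  rwa [List.filter_eq_self.2 (by simpa using hBJ)] at this

end Parabolic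

/-! ### Diamond-closed order ideals -/

theorem swap_braid {i j k : Fin n} (hij : i ≠ j) (hjk : j ≠ k) (hik : i ≠ k) :
    Equiv.swap i j * Equiv.swap j k * Equiv.swap i j =
      Equiv.swap j k * Equiv.swap i j * Equiv.swap j k := by
  rw [Equiv.mul_swap_eq_swap_mul, mul_assoc, Equiv.Perm.mul_apply, Equiv.Perm.mul_apply,
    Equiv.swap_apply_of_ne_of_ne hij hik, Equiv.swap_apply_left, Equiv.swap_apply_left,
    Equiv.swap_apply_of_ne_of_ne hik.symm hjk.symm]

/-- Two simple reflections commute or satisfy the braid relation. -/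
theorem commute_or_braid {s t : Equiv.Perm (Fin n)} (hs : s ∈ simpleReflections n)
    (ht : t ∈ simpleReflections n) : s * t = t * s ∨ s * t * s = t * s * t := by
  obtain ⟨i, j, hij, rfl⟩ := hs
  obtain ⟨k, l, hkl, rfl⟩ := ht
  by_cases h1 : j = k
  · subst h1
    exact Or.inr (swap_braid (by omega) (by omega) (by omega))
  by_cases h2 : l = i
  · subst h2
    exact Or.inr (swap_braid (by omega) (by omega) (by omega)).symm
  by_cases h3 : i = k
  · obtain rfl : j = l := Fin.ext (by omega)
    rw [h3]
    exact Or.inl rfl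
  · left
    rw [Equiv.mul_swap_eq_swap_mul, Equiv.swap_apply_of_ne_of_ne (Ne.symm h3) (Ne.symm h1),
      Equiv.swap_apply_of_ne_of_ne h2 (by omega)]

/-- A diamond-closed set contains the top of a diamond whose other vertices it contains. -/
theorem IsDiamondClosed.top_mem {u v : Equiv.Perm (Fin n)} {I : Set (Equiv.Perm (Fin n))}
    (hI : IsDiamondClosed u v I) (hIv : I ⊆ interval u v) {w a b x : Equiv.Perm (Fin n)}
    (hab : a ≠ b) (hwa : Edge w a) (hwb : Edge w b) (hax : Edge a x) (hbx : Edge b x)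
    (hw : w ∈ I) (ha : a ∈ I) (hb : b ∈ I) (hx : x ∈ interval u v) : x ∈ I := by
  let f : Finset (Fin 2) → Equiv.Perm (Fin n) := fun S ↦
    if 0 ∈ S then (if 1 ∈ S then x else a) else (if 1 ∈ S then b else w)
  have h0 : f ∅ = w := by simp [f]
  have h1 : f {0} = a := by simp [f]
  have h2 : f {1} = b := by simp [f]
  have h3 : f {0, 1} = x := by simp [f]
  have hcases : ∀ S : Finset (Fin 2), S = ∅ ∨ S = {0} ∨ S = {1} ∨ S = {0, 1} := by decide
  have n1 : w ≠ a := fun h ↦ hwa.2.ne (by rw [h])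
  have n2 : w ≠ b := fun h ↦ hwb.2.ne (by rw [h])
  have n3 : a ≠ x := fun h ↦ hax.2.ne (by rw [h])
  have n4 : b ≠ x := fun h ↦ hbx.2.ne (by rw [h])
  have n5 : w ≠ x := fun h ↦ (hwa.2.trans hax.2).ne (by rw [h])
  have hf : IsHypercubeMap u v f := by
    refine ⟨fun S T hST ↦ ?_, fun S ↦ ?_, fun S T hST ↦ ?_⟩
    · rcases hcases S with rfl | rfl | rfl | rfl <;>
        rcases hcases T with rfl | rfl | rfl | rfl <;>
        simp only [h0, h1, h2, h3] at hST <;>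
        first
          | rfl
          | exact absurd hST ‹_›
          | exact absurd hST.symm ‹_›
    · rcases hcases S with rfl | rfl | rfl | rfl
      · exact h0 ▸ hIv hw
      · exact h1 ▸ hIv ha
      · exact h2 ▸ hIv hb
      · exact h3 ▸ hx
    · have hcard := Finset.covBy_iff_card_sdiff_eq_one.1 hST
      rcases hcases S with rfl | rfl | rfl | rfl <;>
        rcases hcases T with rfl | rfl | rfl | rfl <;>
        first
          | (exfalso; revert hcard; decide)
          | (simp only [h0, h1, h2, h3]; assumption)
  rw [← h3]
  refine hI f hf _ fun T hT ↦ ?_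
  rcases hcases T with rfl | rfl | rfl | rfl
  · rwa [h0]
  · rwa [h1]
  · rwa [h2]
  · exact absurd rfl hT

section DiamondClosed

variable {v : Equiv.Perm (Fin n)} {I : Set (Equiv.Perm (Fin n))}

theorem IsOrderIdeal.mem_of_le (hI : IsOrderIdeal 1 v I) {x y : Equiv.Perm (Fin n)}
    (hx : x ∈ I) (h : Le y x) : y ∈ I :=
  hI.2 x hx y ⟨one_le y, Relation.ReflTransGen.trans h (hI.1 hx).2⟩ h

theorem IsOrderIdeal.mem_closure (hI : IsOrderIdeal 1 v I) {x : Equiv.Perm (Fin n)}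
    (hx : x ∈ I) : x ∈ Subgroup.closure (I ∩ simpleReflections n) := by
  obtain ⟨L, hL, rfl, hlen⟩ := exists_reduced_word x
  refine prod_mem_closure fun s hs ↦ ⟨hI.mem_of_le hx ?_, hL s hs⟩
  simpa using prod_le_prod_of_sublist hL hlen (List.singleton_sublist.2 hs)

theorem IsDiamondClosed.mem_of_mem_closure (hI : IsOrderIdeal 1 v I) (hne : I.Nonempty)
    (hd : IsDiamondClosed 1 v I) (x : Equiv.Perm (Fin n)) (hxv : x ∈ interval 1 v)
    (hx : x ∈ Subgroup.closure (I ∩ simpleReflections n)) : x ∈ I := by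
  have hJ : I ∩ simpleReflections n ⊆ simpleReflections n := Set.inter_subset_right
  induction hk : length x using Nat.strong_induction_on generalizing x with
  | _ k ih =>
    subst hk
    have below : ∀ y, Edge y x → y ∈ Subgroup.closure (I ∩ simpleReflections n) → y ∈ I :=
      fun y hy hyJ ↦ ih _ hy.2 y ⟨one_le y, .head hy hxv.2⟩ hyJ rfl
    obtain ⟨L, hL, hLx, hlen⟩ := exists_reduced_word x
    match L with
    | [] =>
      obtain ⟨y, hy⟩ := hne
      rw [← hLx]
      exact hI.mem_of_le hy (one_le y)
    | [s] =>
      obtain rfl : s = x := by simpa using hLx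
      exact (simple_mem_of_mem_closure hJ (hL s (by simp)) hx).1
    | s :: t :: M =>
      have hs : s ∈ simpleReflections n := hL s (by simp)
      have ht : t ∈ simpleReflections n := hL t (by simp)
      have hMw : IsWord M := fun r hr ↦ hL r (by simp [hr])
      simp only [List.prod_cons, List.length_cons] at hLx hlen
      set w := M.prod with hw
      have l1 : length w ≤ M.length := length_prod_le hMw
      have l2 := length_simple_mul_le ht w
      have l3 := length_simple_mul_le hs (t * w)
      have l4 := length_simple_mul_le hs w
      rw [hLx] at l3
      have rs := IsReflection.of_simple hs
      have rt := IsReflection.of_simple ht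
      have hst : s ≠ t := by
        rintro rfl
        rw [simple_mul_cancel hs] at hLx
        rw [← hLx] at hlen
        omega
      have htw : t * w = s * x := by rw [← hLx, simple_mul_cancel hs]
      have hsJ : s ∈ I ∩ simpleReflections n :=
        descent_mem hJ hs hx (by rw [← htw]; omega)
      have htwJ : t * w ∈ Subgroup.closure (I ∩ simpleReflections n) :=
        htw ▸ mul_mem (Subgroup.subset_closure hsJ) hx
      have htJ : t ∈ I ∩ simpleReflections n :=
        descent_mem hJ ht htwJ (by rw [simple_mul_cancel ht]; omega)
      have hsC := Subgroup.subset_closure hsJ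
      have htC := Subgroup.subset_closure htJ
      have hwJ : w ∈ Subgroup.closure (I ∩ simpleReflections n) :=
        (Subgroup.mul_mem_cancel_left _ htC).1 htwJ
      have e1 : Edge w (t * w) := edge_mul rt (by omega)
      have e2 : Edge (t * w) x := hLx ▸ edge_mul rs (by rw [hLx]; omega)
      have itw := below _ e2 htwJ
      have iw : w ∈ I := hI.mem_of_le itw (.single e1)
      -- The middle vertex other than `t * w` depends on whether `s` is a descent of `w`.
      rcases length_mul_lt_or_gt rs w with hlt | hlt
      · have hx' : s * t * s * (s * w) = x := by
          rw [mul_assoc, simple_mul_cancel hs, mul_assoc, hLx]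
        -- If s and t commuted, x would equal t(sw), which is too short; so the braid relation gives
        -- x = t(stsw).
        rcases commute_or_braid hs ht with hc | hb
        · exfalso
          rw [hc, mul_assoc t, simple_mul_self hs, mul_one] at hx'
          have := length_simple_mul_le ht (s * w)
          rw [hx'] at this
          omega
        · have hx2 : t * (s * (t * (s * w))) = x := by
            rw [← hx', hb]
            simp only [mul_assoc]
          have m1 := length_simple_mul_le ht (s * w)
          have m2 := length_simple_mul_le hs (t * (s * w))
          have m3 := length_simple_mul_le ht (s * (t * (s * w)))
          rw [hx2] at m3
          have heq : s * (t * (s * w)) = (s * t * s⁻¹) * w := by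
            rw [simple_inv hs]
            simp only [mul_assoc]
          have e3 : Edge w (s * (t * (s * w))) := by
            rw [heq]
            exact edge_mul (rt.conj s) (by rw [← heq]; omega)
          have e4 : Edge (s * (t * (s * w))) x := by
            have h := edge_mul (x := s * (t * (s * w))) rt (by rw [hx2]; omega)
            rwa [hx2] at h
          refine hd.top_mem hI.1 ?_ e1 e3 e2 e4 iw itw
            (below _ e4 (mul_mem hsC (mul_mem htC (mul_mem hsC hwJ)))) hxv
          -- Equal middle vertices would give t = sts = tst, hence st = 1.
          intro h
          have h' : t = s * t * s := mul_right_cancel (b := w) (by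
            rw [h]
            simp only [mul_assoc])
          rw [hb, mul_assoc] at h'
          have h2 := mul_eq_left.1 h'.symm
          exact hst (by rw [← simple_inv ht]; exact eq_inv_of_mul_eq_one_left h2)
      · have heq : x = (s * t * s⁻¹) * (s * w) := by
          rw [← hLx]
          group
        have e3 : Edge w (s * w) := edge_mul rs hlt
        have e4 : Edge (s * w) x := by
          have h := edge_mul (x := s * w) (rt.conj s) (by rw [← heq]; omega)
          rwa [← heq] at h
        exact hd.top_mem hI.1 (fun h ↦ hst (mul_right_cancel h).symm) e1 e3 e2 e4 iw itw
          (below _ e4 (mul_mem hsC hwJ)) hxv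

theorem IsDiamondClosed.eq_inter_closure (hI : IsOrderIdeal 1 v I) (hne : I.Nonempty)
    (hd : IsDiamondClosed 1 v I) :
    I = interval 1 v ∩
      (Subgroup.closure (I ∩ simpleReflections n) : Set (Equiv.Perm (Fin n))) :=
  Set.Subset.antisymm (fun _ hx ↦ ⟨hI.1 hx, hI.mem_closure hx⟩)
    fun x hx ↦ hd.mem_of_mem_closure hI hne x hx.1 hx.2

/-- The first letter of a reduced word lies below the element, and a one-letter word has only two
subwords. -/
theorem IsOrderIdeal.atoms_eq (hI : IsOrderIdeal 1 v I) :
    atoms 1 I = I ∩ simpleReflections n := by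
  ext x
  constructor
  · rintro ⟨hx, hx1, hmin⟩
    obtain ⟨L, hL, rfl, hlen⟩ := exists_reduced_word x
    cases L with
    | nil => exact absurd rfl hx1
    | cons s L =>
      have hs : s ∈ simpleReflections n := hL s (by simp)
      have hle : Le s (s :: L).prod := by
        simpa using prod_le_prod_of_sublist hL hlen
          (List.singleton_sublist.2 (List.mem_cons_self (a := s) (l := L)))
      have := (hmin s (hI.mem_of_le hx hle) hle).resolve_left (simple_ne_one hs)
      exact ⟨hx, this ▸ hs⟩
  · rintro ⟨hx, hs⟩
    refine ⟨hx, simple_ne_one hs, fun y _ hy ↦ ?_⟩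
    obtain ⟨M, hM, rfl⟩ := hy.exists_sublist (L := [x]) (by simpa [IsWord] using hs) (by simp)
    rcases List.sublist_singleton.1 hM with rfl | rfl <;> simp

end DiamondClosed

end BruhatSn

theorem proposition4p2 (n : ℕ) (v : Equiv.Perm (Fin n)) :
    (∀ I : Set (Equiv.Perm (Fin n)),
      BruhatSn.IsOrderIdeal 1 v I → I.Nonempty → BruhatSn.IsDiamondClosed 1 v I →
        (∃ J : Set (Equiv.Perm (Fin n)), J ⊆ BruhatSn.simpleReflections n ∧
          I = BruhatSn.interval 1 v ∩ (Subgroup.closure J : Set (Equiv.Perm (Fin n)))) ∧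
        BruhatSn.IsPrincipalOrderIdeal 1 v I) ∧
    (∀ I : Set (Equiv.Perm (Fin n)),
      BruhatSn.IsHypercubeDecomposition 1 v I →
        BruhatSn.atoms 1 I ⊆ BruhatSn.simpleReflections n ∧
        I = BruhatSn.interval 1 v ∩
          (Subgroup.closure (BruhatSn.atoms 1 I) : Set (Equiv.Perm (Fin n)))) := by
  refine ⟨fun I hI hne hd ↦ ?_, ?_⟩
  · have h := hd.eq_inter_closure hI hne
    refine ⟨⟨_, Set.inter_subset_right, h⟩, ?_⟩
    rw [h]
    exact BruhatSn.isPrincipalOrderIdeal_inter_closure Set.inter_subset_right v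
  · rintro I ⟨⟨z, hz, rfl⟩, hd, -⟩
    have hI : BruhatSn.IsOrderIdeal 1 v (BruhatSn.interval 1 z) :=
      ⟨fun x hx ↦ ⟨hx.1, Relation.ReflTransGen.trans hx.2 hz.2⟩,
        fun x hx y hy hyx ↦ ⟨hy.1, Relation.ReflTransGen.trans hyx hx.2⟩⟩
    rw [hI.atoms_eq]
    exact ⟨Set.inter_subset_right,
      BruhatSn.IsDiamondClosed.eq_inter_closure hI ⟨1, .refl, hz.1⟩ hd⟩
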